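/- Let $X$ be a measurable space, $Y\subseteq\mathbb R$, and $\rho$ a probability measure on $X\times Y$. Let $\mathcal F$ be a real separable Hilbert space, $\Phi:X\to\mathcal F$ a measurable feature map, and $V:\mathbb R\times\mathbb R\to\mathbb R_+$ a measurable loss function such that $V(y,\cdot)$ is convex for every $y\in Y$, with left derivative $V'_-(y,\cdot)$. For $w\in\mathcal F$ let $$\mathcal E(w)=\int V(y,\langle w,\Phi(x)\rangle)\,d\rho(x,y).$$ Assume: 1. (Boundedness) $\kappa=\sup_{x\in X}\|\Phi(x)\|<\infty$, $\sup_{y\in Y}V(y,0)<\infty$, and $|V'_-(y,a)|\le a_0$ for all $a\in\mathbb R$, $y\in Y$. 2. (Approximation error) For some $\beta\in(0,1]$ and $c_\beta>0$, $$\mathcal D(\lambda)=\inf_{w\in\mathcal F}\Big\{\mathcal E(w)+\frac{\lambda}{2}\|w\|^2\Big\}-\inf_{w\in\mathcal F}\mathcal E(w)\le c_\beta\lambda^\beta\quad\text{for all }\lambda>0.$$ 3. (Smoothness) For every $y\in Y$, $V(y,\cdot)$ is differentiable and its derivative is Lipschitz continuous with constant $L>0$. Let $m\ge 1$ and let $\mathbf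 z=(x_i,y_i)_{i=1}^m$ be an i.i.d. sample from $\rho$. Given $\mathbf z$, let $j_1,j_2,\dots$ be i.i.d. uniform on $\{1,\dots,m\}$. Run the stochastic gradient method $w_1=0$, $$w_{t+1}=w_t-\eta_t V'_-(y_{j_t},\langle w_t,\Phi(x_{j_t})\rangle)\Phi(x_{j_t}),\qquad t\ge1,$$ with the constant step-size $\eta_t=\eta_1 m^{-\beta/(\beta+1)}$, where $\eta_1>0$ is a constant with $\eta_1\kappa^2L\le 2$, and let $\overline w_t=\sum_{k=1}^t\eta_kw_k\big/\sum_{k=1}^t\eta_k$. Here $\eta_1$ in the formula for $\eta_t$ denotes this constant, not the first step-size. Then there is a constant $C>0$, depending only on $\beta,c_\beta,a_0,\kappa,\eta_1$, such that for all $m\ge1$, all $t\ge1$, and both for $g_t=\overline w_t$ and for $g_t=w_t$, the excess risk of $g_t$ is integrable and $$\mathbb E\Big[\mathcal E(g_t)-\inf_{w\in\mathcal F}\mathcal E(w)\Big]\le C\Big(m^{-\frac{2\beta+1}{\beta+1}}\,t\log t+m^{-\frac{\beta}{\beta+1}}\log t+m^{\frac{\beta^2}{\beta+1}}\,t^{-\beta}\Big),$$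 the expectation being taken over $\mathbf z$ and the indices $j_1,j_2,\dots$. In particular, with one pass, $t^*=m$, for all $m\ge2$, $$\mathbb E\Big[\mathcal E(g_m)-\inf_{w\in\mathcal F}\mathcal E(w)\Big]\le C\,m^{-\frac{\beta}{\beta+1}}\log m .$$ -/

import Mathlib

open MeasureTheory

universe u v

noncomputable section

namespace SGM

/-- The left-hand derivative `f'_-(a)` of a function of one real variable. -/
def leftDeriv (f : ℝ → ℝ) (a : ℝ) : ℝ := derivWithin f (Set.Iio a) a

/-- A measurable loss `V : ℝ × ℝ → ℝ₊`, convex in its second entry for every label in `Y`. -/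
structure IsConvexLoss (Y : Set ℝ) (V : ℝ → ℝ → ℝ) : Prop where
  measurable : Measurable (Function.uncurry V)
  nonneg : ∀ y a, 0 ≤ V y a
  convex : ∀ y ∈ Y, ConvexOn ℝ Set.univ (V y)

section Risk

variable {X F : Type*} [MeasurableSpace X] [NormedAddCommGroup F] [InnerProductSpace ℝ F]
  {Y : Set ℝ}

/-- Boundedness: `κ = sup_x √⟨Φ x, Φ x⟩ < ∞`, `sup_{y ∈ Y} V(y, 0) < ∞`, and the left derivatives
`V'_-(y, ·)`, `y ∈ Y`, are bounded by `a₀`. -/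
structure IsBounded (Y : Set ℝ) (V : ℝ → ℝ → ℝ) (Φ : X → F) (a₀ κ : ℝ) : Prop where
  feature : IsLUB (Set.range fun x => Real.sqrt (inner ℝ (Φ x) (Φ x))) κ
  loss_zero : BddAbove ((fun y => V y 0) '' Y)
  leftDeriv_le : ∀ y ∈ Y, ∀ a, |leftDeriv (V y) a| ≤ a₀

/-- Smoothness: each `V(y, ·)`, `y ∈ Y`, is differentiable with `L`-Lipschitz derivative. -/
structure IsSmoothLoss (Y : Set ℝ) (V : ℝ → ℝ → ℝ) (L : ℝ) : Prop where
  differentiable : ∀ y ∈ Y, Differentiable ℝ (V y)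
  lipschitz : ∀ y ∈ Y, ∀ a b, |deriv (V y) b - deriv (V y) a| ≤ L * |b - a|

/-- The expected risk `𝓔(w) = ∫ V(y, ⟨w, Φ x⟩) dρ(x, y)`. -/
def risk (ρ : Measure (X × Y)) (V : ℝ → ℝ → ℝ) (Φ : X → F) (w : F) : ℝ :=
  ∫ z, V z.2 (inner ℝ w (Φ z.1)) ∂ρ

/-- The excess risk `𝓔(w) - inf 𝓔`. -/
def excessRisk (ρ : Measure (X × Y)) (V : ℝ → ℝ → ℝ) (Φ : X → F) (w : F) : ℝ :=
  risk ρ V Φ w - ⨅ v : F, risk ρ V Φ v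

/-- The approximation error `𝓓(l) = inf_w {𝓔(w) + (l/2) ‖w‖²} - inf_w 𝓔(w)`. -/
def approxError (ρ : Measure (X × Y)) (V : ℝ → ℝ → ℝ) (Φ : X → F) (l : ℝ) : ℝ :=
  (⨅ w : F, (risk ρ V Φ w + l / 2 * ‖w‖ ^ 2)) - ⨅ w : F, risk ρ V Φ w

/-- The iterates of the stochastic gradient method on the sample `z` with step-sizes `η` and
index sequence `j`: `w₁ = 0` and
`w_{t+1} = w_t - η_t V'_-(y_{j_t}, ⟨w_t, Φ(x_{j_t})⟩) Φ(x_{j_t})` for `t ≥ 1`.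
The value at `0` is a placeholder, and `η 0`, `j 0` are never used. -/
def iterate (V : ℝ → ℝ → ℝ) (Φ : X → F) (η : ℕ → ℝ) {m : ℕ} (z : Fin m → X × Y)
    (j : ℕ → Fin m) : ℕ → F
  | 0 => 0
  | 1 => 0
  | t + 2 =>
    iterate V Φ η z j (t + 1) -
      (η (t + 1) * leftDeriv (V (z (j (t + 1))).2)
        (inner ℝ (iterate V Φ η z j (t + 1)) (Φ (z (j (t + 1))).1))) • Φ (z (j (t + 1))).1

/-- The weighted averages `(∑_{k=1}^t η_k)⁻¹ ∑_{k=1}^t η_k w_k`. -/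
def averagedIterate (V : ℝ → ℝ → ℝ) (Φ : X → F) (η : ℕ → ℝ) {m : ℕ} (z : Fin m → X × Y)
    (j : ℕ → Fin m) (t : ℕ) : F :=
  (∑ k ∈ Finset.Icc 1 t, η k)⁻¹ • ∑ k ∈ Finset.Icc 1 t, η k • iterate V Φ η z j k

/-- The joint law of the sample and the index sequence: `z₁, …, z_m` are i.i.d. with law `ρ` and,
given the sample, the indices are i.i.d. uniform on the `m` sample points. -/
def law (ρ : Measure (X × Y)) (m : ℕ) [NeZero m] : Measure ((Fin m → X × Y) × (ℕ → Fin m)) :=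
  (Measure.pi fun _ : Fin m => ρ).prod
    (Measure.infinitePi fun _ : ℕ => (PMF.uniformOfFintype (Fin m)).toMeasure)

/-- The expected excess risk of the random vector `g(z, J)` is well defined and at most `B`. -/
def ExpectedExcessRiskLE (ρ : Measure (X × Y)) (V : ℝ → ℝ → ℝ) (Φ : X → F) (m : ℕ) [NeZero m]
    (g : (Fin m → X × Y) → (ℕ → Fin m) → F) (B : ℝ) : Prop :=
  Integrable (fun p : (Fin m → X × Y) × (ℕ → Fin m) => excessRisk ρ V Φ (g p.1 p.2)) (law ρ m) ∧
    ∫ p, excessRisk ρ V Φ (g p.1 p.2) ∂(law ρ m) ≤ B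

end Risk

end SGM

end

/-! Write `G = a₀ * κ` for the gradient bound and `η` for the constant step. Against any fixed
comparator `u`, the expected risk of the output splits into a generalization gap and an optimization
error.

Generalization is a matter of stability. Smooth convex losses have cocoercive derivatives, so each
gradient step is nonexpansive when `η * (κ ^ 2 * L) ≤ 2`. Replacing one sample point then perturbs
the trajectory only at the steps that draw it, by at most `2 * η * G` each time
(`norm_sgd_update_sub_le`). Averaging over the `m` points gives a gap of at most `2 * η * G ^ 2 * t
/ m` (`integral_popRisk_sub_empRisk_le`).

Optimization is the usual telescoping of squared distances, since a fresh uniform index turns the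
loss into the empirical risk (`sum_integral_empRisk_sub_le`). With `u` fixed it controls averages.
With the comparator taken to be an earlier iterate it controls suffix averages, and
`head_le_average_add_harmonic` converts these into a bound on the last iterate at the price of a
harmonic sum.

The comparator contributes `‖u‖ ^ 2 / (2 * (η * t))`, which is the penalty in `approxError` at `(η *
t)⁻¹`. Minimizing over `u` and inserting the step-size gives the three terms of the rate. -/

noncomputable section

namespace SGM

/-! ### Resampling one coordinate of a product measure -/

section Resampling

variable {ι : Type*} {X : ι → Type*} [∀ i, MeasurableSpace (X i)]

/-- Replacing one coordinate by an independent copy preserves a product measure. -/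
theorem measurePreserving_update_infinitePi [DecidableEq ι] (μ : ∀ i, Measure (X i))
    [∀ i, IsProbabilityMeasure (μ i)] (i : ι) :
    MeasurePreserving (fun p : (∀ i, X i) × X i => Function.update p.1 i p.2)
      ((Measure.infinitePi μ).prod (μ i)) (Measure.infinitePi μ) := by
  refine ⟨measurable_update', Measure.eq_infinitePi μ fun s t ht => ?_⟩
  rw [Measure.map_apply measurable_update'
    (MeasurableSet.pi s.countable_toSet fun j _ => ht j)]
  by_cases hi : i ∈ s
  · have : (fun p : (∀ i, X i) × X i => Function.update p.1 i p.2) ⁻¹' Set.pi s t =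
        Set.pi (s.erase i) t ×ˢ t i := by
      ext ⟨x, a⟩
      simp only [Set.mem_preimage, Set.mem_pi, Finset.mem_coe, Set.mem_prod, Finset.mem_erase]
      constructor
      · intro h
        refine ⟨fun j hj => ?_, ?_⟩
        · simpa [Function.update_of_ne hj.1] using h j hj.2
        · simpa using h i hi
      · rintro ⟨h, ha⟩ j hj
        by_cases hji : j = i
        · subst hji; simpa using ha
        · simpa [Function.update_of_ne hji] using h j ⟨hji, hj⟩
    rw [this, Measure.prod_prod, Measure.infinitePi_pi μ fun j _ => ht j,
      Finset.prod_erase_mul _ _ hi]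
  · have : (fun p : (∀ i, X i) × X i => Function.update p.1 i p.2) ⁻¹' Set.pi s t =
        Set.pi s t ×ˢ Set.univ := by
      ext ⟨x, a⟩
      simp only [Set.mem_preimage, Set.mem_pi, Finset.mem_coe, Set.mem_prod, Set.mem_univ,
        and_true]
      refine forall₂_congr fun j hj => ?_
      rw [Function.update_of_ne (by rintro rfl; exact hi hj)]
    rw [this, Measure.prod_prod, Measure.infinitePi_pi μ fun j _ => ht j, measure_univ, mul_one]

/-- Used twice: with a fresh index in the optimization bound, and with a fresh sample point in the
stability bound. -/
theorem integral_infinitePi_update [DecidableEq ι] (μ : ∀ i, Measure (X i))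
    [∀ i, IsProbabilityMeasure (μ i)] (i : ι) {f : (∀ i, X i) → ℝ}
    (hf : Integrable f (Measure.infinitePi μ)) :
    ∫ x, f x ∂Measure.infinitePi μ =
      ∫ x, ∫ a, f (Function.update x i a) ∂μ i ∂Measure.infinitePi μ := by
  have h := measurePreserving_update_infinitePi μ i
  have hint : Integrable (fun p : (∀ i, X i) × X i => f (Function.update p.1 i p.2))
      ((Measure.infinitePi μ).prod (μ i)) := h.integrable_comp_of_integrable hf
  have hs : AEStronglyMeasurable f (((Measure.infinitePi μ).prod (μ i)).map
      fun p : (∀ i, X i) × X i => Function.update p.1 i p.2) := by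
    rw [h.map_eq]; exact hf.aestronglyMeasurable
  calc ∫ x, f x ∂Measure.infinitePi μ
      = ∫ x, f x ∂(((Measure.infinitePi μ).prod (μ i)).map
          fun p : (∀ i, X i) × X i => Function.update p.1 i p.2) := by rw [h.map_eq]
    _ = ∫ p, f (Function.update p.1 i p.2) ∂((Measure.infinitePi μ).prod (μ i)) :=
        integral_map h.measurable.aemeasurable hs
    _ = _ := integral_prod _ hint

theorem integral_uniformOfFintype_fin {m : ℕ} [NeZero m] (f : Fin m → ℝ) :
    ∫ i, f i ∂(PMF.uniformOfFintype (Fin m)).toMeasure = (m : ℝ)⁻¹ * ∑ i, f i := by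
  rw [PMF.integral_eq_sum, Finset.mul_sum]
  refine Finset.sum_congr rfl fun i _ => ?_
  simp

end Resampling

/-! ### From suffix averages to the last term -/

/-- If every suffix average exceeds its first term by at most `c`, the last term exceeds the
average by at most `c` times a harmonic number. Here `b` is the sequence read backwards. -/
theorem head_le_average_add_harmonic (b : ℕ → ℝ) (c : ℝ) (t : ℕ)
    (hb : ∀ k < t, ∑ i ∈ Finset.range (k + 1), b i ≤ (k + 1) * (b k + c)) :
    ∀ n < t, b 0 ≤ (∑ i ∈ Finset.range (n + 1), b i) / (n + 1) + c * (harmonic n : ℝ) := by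
  intro n
  induction n with
  | zero => intro _; simp
  | succ n ih =>
    intro hn
    refine (ih (by omega)).trans ?_
    have h := hb (n + 1) hn
    rw [Finset.sum_range_succ] at h
    rw [Finset.sum_range_succ _ (n + 1)]
    set T := ∑ i ∈ Finset.range (n + 1), b i
    have hn0 : (0 : ℝ) < n + 1 := by positivity
    rw [harmonic_succ]
    push_cast at h ⊢
    -- The two averages differ by `(T - (n + 1) * b (n + 1)) / ((n + 1) * (n + 2))`, and `h` bounds
    -- that numerator by `(n + 2) * c`.
    have key : T / (n + 1) ≤ (T + b (n + 1)) / (n + 1 + 1) + c * ((n : ℝ) + 1)⁻¹ := by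
      rw [← div_eq_mul_inv, div_add_div _ _ (by positivity) (by positivity),
        div_le_div_iff₀ (by positivity) (by positivity)]
      nlinarith
    linarith

/-! ### Iterates and empirical risk -/

section Iterates

variable {Z F : Type*} [NormedAddCommGroup F] [InnerProductSpace ℝ F]

/-- Stochastic (sub)gradient iterates with constant step-size `η`, started at `w₁ = 0`. -/
def sgd (g : Z → F → F) (η : ℝ) {m : ℕ} (z : Fin m → Z) (j : ℕ → Fin m) : ℕ → F
  | 0 => 0
  | 1 => 0
  | t + 2 => sgd g η z j (t + 1) - η • g (z (j (t + 1))) (sgd g η z j (t + 1))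

variable {g : Z → F → F} {η : ℝ}

theorem sgd_succ {m : ℕ} (z : Fin m → Z) (j : ℕ → Fin m) {t : ℕ} (ht : 1 ≤ t) :
    sgd g η z j (t + 1) = sgd g η z j t - η • g (z (j t)) (sgd g η z j t) := by
  obtain ⟨t, rfl⟩ := Nat.exists_eq_add_of_le' ht
  rfl

theorem sgd_one {m : ℕ} (z : Fin m → Z) (j : ℕ → Fin m) : sgd g η z j 1 = 0 := rfl

/-- The iterate at time `t` has only used indices before `t`, so `j k` is independent of it for `k ≥
t`. -/
theorem sgd_update_index {m : ℕ} (z : Fin m → Z) (j : ℕ → Fin m) (k : ℕ) (i : Fin m) :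
    ∀ t ≤ k, sgd g η z (Function.update j k i) t = sgd g η z j t
  | 0, _ => rfl
  | 1, _ => rfl
  | t + 2, h => by
    rw [sgd_succ (t := t + 1) _ _ (by omega), sgd_succ (t := t + 1) _ _ (by omega),
      sgd_update_index z j k i (t + 1) (by omega), Function.update_of_ne (by omega)]

/-- The empirical risk on the sample `z`. -/
def empRisk (ℓ : Z → F → ℝ) {m : ℕ} (z : Fin m → Z) (w : F) : ℝ :=
  (m : ℝ)⁻¹ * ∑ i, ℓ (z i) w

end Iterates

/-! ### Pathwise estimates for nonexpansive subgradient steps -/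

section Abstract

variable {Z F : Type*} [MeasurableSpace Z] [NormedAddCommGroup F] [InnerProductSpace ℝ F]
  [MeasurableSpace F]

/-- A measurable family of nonnegative losses `ℓ z` with bounded subgradients `g z` for which the
steps `w ↦ w - η g z w` are nonexpansive. -/
structure IsNonexpansiveSubgradient (ℓ : Z → F → ℝ) (g : Z → F → F) (η G M : ℝ) : Prop where
  measurable_loss : Measurable (Function.uncurry ℓ)
  measurable_grad : Measurable (Function.uncurry g)
  step_pos : 0 < η
  bound_nonneg : 0 ≤ G
  loss_nonneg : ∀ z w, 0 ≤ ℓ z w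
  loss_zero_le : ∀ z, ℓ z 0 ≤ M
  norm_grad_le : ∀ z w, ‖g z w‖ ≤ G
  subgradient : ∀ z w v, ℓ z w + inner ℝ (g z w) (v - w) ≤ ℓ z v
  nonexpansive : ∀ z w v, ‖(w - η • g z w) - (v - η • g z v)‖ ≤ ‖w - v‖

variable {ℓ : Z → F → ℝ} {g : Z → F → F} {η G M : ℝ}


namespace IsNonexpansiveSubgradient

theorem abs_loss_sub_le (h : IsNonexpansiveSubgradient ℓ g η G M) (z : Z) (w v : F) :
    |ℓ z w - ℓ z v| ≤ G * ‖w - v‖ := by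
  have key : ∀ w v : F, ℓ z w - ℓ z v ≤ G * ‖w - v‖ := fun w v => by
    have h1 := h.subgradient z w v
    have h2 := (abs_le.1 (abs_real_inner_le_norm (g z w) (v - w))).1
    have h3 := mul_le_mul_of_nonneg_right (h.norm_grad_le z w) (norm_nonneg (v - w))
    rw [norm_sub_rev w v]
    linarith
  rw [abs_le]
  have := key v w
  rw [norm_sub_rev] at this
  exact ⟨by linarith, key w v⟩

/-- Serves integrability only: iterates at a fixed time lie in a fixed ball. This is why `M` is
absent from the final constant. -/
theorem abs_loss_le (h : IsNonexpansiveSubgradient ℓ g η G M) (z : Z) {w : F} {R : ℝ}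
    (hw : ‖w‖ ≤ R) : |ℓ z w| ≤ M + G * R := by
  have h1 := (abs_le.1 (h.abs_loss_sub_le z w 0)).2
  rw [sub_zero] at h1
  rw [abs_of_nonneg (h.loss_nonneg z w)]
  have := mul_le_mul_of_nonneg_left hw h.bound_nonneg
  linarith [h.loss_zero_le z]

theorem norm_sgd_le (h : IsNonexpansiveSubgradient ℓ g η G M) {m : ℕ} (z : Fin m → Z)
    (j : ℕ → Fin m) : ∀ t : ℕ, ‖sgd g η z j t‖ ≤ η * G * t
  | 0 => by simp [sgd]
  | 1 => by simpa [sgd] using mul_nonneg h.step_pos.le h.bound_nonneg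
  | t + 2 => by
    rw [sgd_succ _ _ (by omega)]
    refine (norm_sub_le _ _).trans ?_
    rw [norm_smul, Real.norm_of_nonneg h.step_pos.le]
    have h1 := h.norm_sgd_le z j (t + 1)
    have h2 := mul_le_mul_of_nonneg_left
      (h.norm_grad_le (z (j (t + 1))) (sgd g η z j (t + 1))) h.step_pos.le
    push_cast at h1 ⊢
    linarith

theorem norm_sgd_succ_sub_sq_le (h : IsNonexpansiveSubgradient ℓ g η G M) {m : ℕ}
    (z : Fin m → Z) (j : ℕ → Fin m) {t : ℕ} (ht : 1 ≤ t) (u : F) :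
    ‖sgd g η z j (t + 1) - u‖ ^ 2 ≤ ‖sgd g η z j t - u‖ ^ 2 + (η * G) ^ 2 -
      2 * η * (ℓ (z (j t)) (sgd g η z j t) - ℓ (z (j t)) u) := by
  rw [sgd_succ _ _ ht]
  set w := sgd g η z j t
  have h1 := h.subgradient (z (j t)) w u
  have h2 : w - η • g (z (j t)) w - u = (w - u) - η • g (z (j t)) w := by abel
  have h3 : ‖η • g (z (j t)) w‖ ≤ η * G := by
    rw [norm_smul, Real.norm_of_nonneg h.step_pos.le]
    exact mul_le_mul_of_nonneg_left (h.norm_grad_le _ _) h.step_pos.le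
  have h4 := pow_le_pow_left₀ (norm_nonneg _) h3 2
  have h5 : inner ℝ (g (z (j t)) w) (u - w) = -inner ℝ (w - u) (g (z (j t)) w) := by
    rw [real_inner_comm, ← inner_neg_left, neg_sub]
  rw [h2, norm_sub_sq_real, inner_smul_right]
  rw [h5] at h1
  nlinarith [mul_le_mul_of_nonneg_left h1 h.step_pos.le]

/-- Stability: the iterates change little when one sample point is replaced. -/
theorem norm_sgd_update_sub_le (h : IsNonexpansiveSubgradient ℓ g η G M) {m : ℕ}
    (z : Fin m → Z) (i : Fin m) (a b : Z) (j : ℕ → Fin m) :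
    ∀ t : ℕ, ‖sgd g η (Function.update z i a) j t - sgd g η (Function.update z i b) j t‖ ≤
      2 * η * G * ∑ k ∈ Finset.range t, if j k = i then 1 else 0
  | 0 => by simp [sgd]
  | 1 => by
    have := mul_nonneg h.step_pos.le h.bound_nonneg
    simp only [sgd, sub_self, norm_zero]
    refine mul_nonneg (by linarith) (Finset.sum_nonneg fun k _ => ?_)
    split_ifs <;> norm_num
  | t + 2 => by
    rw [sgd_succ (t := t + 1) _ _ (by omega), sgd_succ (t := t + 1) _ _ (by omega),
      Finset.sum_range_succ]
    have ih := h.norm_sgd_update_sub_le z i a b j (t + 1)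
    set w := sgd g η (Function.update z i a) j (t + 1)
    set v := sgd g η (Function.update z i b) j (t + 1)
    by_cases hj : j (t + 1) = i
    -- The replaced point is drawn: the two steps use unrelated gradients, each of length at most `η
    -- * G`.
    · have hs : ∀ c (x : F), ‖η • g c x‖ ≤ η * G := fun c x => by
        rw [norm_smul, Real.norm_of_nonneg h.step_pos.le]
        exact mul_le_mul_of_nonneg_left (h.norm_grad_le _ _) h.step_pos.le
      rw [if_pos hj, hj, Function.update_self, Function.update_self]
      have e : w - η • g a w - (v - η • g b v) = (w - v) - (η • g a w - η • g b v) := by abel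
      rw [e]
      have h1 := norm_sub_le (w - v) (η • g a w - η • g b v)
      have h2 := norm_sub_le (η • g a w) (η • g b v)
      linarith [hs a w, hs b v]
    · rw [if_neg hj, add_zero, Function.update_of_ne hj, Function.update_of_ne hj]
      exact (h.nonexpansive _ _ _).trans ih

end IsNonexpansiveSubgradient

end Abstract

/-- The law of i.i.d. uniform indices. -/
def indexLaw (m : ℕ) [NeZero m] : Measure (ℕ → Fin m) :=
  Measure.infinitePi fun _ : ℕ => (PMF.uniformOfFintype (Fin m)).toMeasure

instance (m : ℕ) [NeZero m] : IsProbabilityMeasure (indexLaw m) := by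
  unfold indexLaw; infer_instance

theorem integrable_of_abs_le {Ω : Type*} [MeasurableSpace Ω] {μ : Measure Ω} [IsFiniteMeasure μ]
    {f : Ω → ℝ} (hf : Measurable f) {c : ℝ} (hc : ∀ x, |f x| ≤ c) : Integrable f μ :=
  Integrable.of_bound hf.aestronglyMeasurable c (Filter.Eventually.of_forall hc)

/-! ### Optimization error in expectation over the indices -/

section Expectation

variable {Z F : Type*} [MeasurableSpace Z] [NormedAddCommGroup F] [InnerProductSpace ℝ F]
  [MeasurableSpace F] [BorelSpace F] [SecondCountableTopology F]
  {ℓ : Z → F → ℝ} {g : Z → F → F} {η G M : ℝ}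

/-- The expected risk. -/
def popRisk (ρ : Measure Z) (ℓ : Z → F → ℝ) (w : F) : ℝ := ∫ z, ℓ z w ∂ρ

theorem measurable_sample_index {m : ℕ} (k : ℕ) :
    Measurable fun p : (Fin m → Z) × (ℕ → Fin m) => p.1 (p.2 k) := by
  have h : Measurable fun q : (Fin m → Z) × Fin m => q.1 q.2 :=
    measurable_from_prod_countable_left fun i => measurable_pi_apply i
  exact h.comp (measurable_fst.prodMk ((measurable_pi_apply k).comp measurable_snd))

namespace IsNonexpansiveSubgradient

theorem measurable_sgd (h : IsNonexpansiveSubgradient ℓ g η G M) {m : ℕ} :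
    ∀ t : ℕ, Measurable fun p : (Fin m → Z) × (ℕ → Fin m) => sgd g η p.1 p.2 t
  | 0 => measurable_const
  | 1 => measurable_const
  | t + 2 => by
    have ih := h.measurable_sgd (m := m) (t + 1)
    have hg : Measurable fun p : (Fin m → Z) × (ℕ → Fin m) =>
        g (p.1 (p.2 (t + 1))) (sgd g η p.1 p.2 (t + 1)) :=
      h.measurable_grad.comp ((measurable_sample_index (t + 1)).prodMk ih)
    exact ih.sub (hg.const_smul η)

theorem measurable_sgd_index (h : IsNonexpansiveSubgradient ℓ g η G M) {m : ℕ} (z : Fin m → Z)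
    (t : ℕ) : Measurable fun j : ℕ → Fin m => sgd g η z j t :=
  (h.measurable_sgd t).comp measurable_prodMk_left

theorem measurable_sgd_sample (h : IsNonexpansiveSubgradient ℓ g η G M) {m : ℕ}
    (j : ℕ → Fin m) (t : ℕ) : Measurable fun z : Fin m → Z => sgd g η z j t :=
  (h.measurable_sgd t).comp measurable_prodMk_right

theorem measurable_loss_comp (h : IsNonexpansiveSubgradient ℓ g η G M) {Ω : Type*}
    [MeasurableSpace Ω] {ζ : Ω → Z} {φ : Ω → F} (hζ : Measurable ζ) (hφ : Measurable φ) :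
    Measurable fun x => ℓ (ζ x) (φ x) :=
  h.measurable_loss.comp (hζ.prodMk hφ)

theorem integrable_loss_comp (h : IsNonexpansiveSubgradient ℓ g η G M) {Ω : Type*}
    [MeasurableSpace Ω] (μ : Measure Ω) [IsFiniteMeasure μ] {ζ : Ω → Z} {φ : Ω → F}
    (hζ : Measurable ζ) (hφ : Measurable φ) {R : ℝ} (hR : ∀ x, ‖φ x‖ ≤ R) :
    Integrable (fun x => ℓ (ζ x) (φ x)) μ :=
  integrable_of_abs_le (h.measurable_loss_comp hζ hφ) fun x => h.abs_loss_le _ (hR x)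

theorem measurable_sample_eval {m : ℕ} (z : Fin m → Z) (k : ℕ) :
    Measurable fun j : ℕ → Fin m => z (j k) :=
  (measurable_of_finite z).comp (measurable_pi_apply k)

theorem integrable_empRisk (h : IsNonexpansiveSubgradient ℓ g η G M) {Ω : Type*}
    [MeasurableSpace Ω] (μ : Measure Ω) [IsFiniteMeasure μ] {m : ℕ} {ζ : Ω → Fin m → Z}
    (hζ : Measurable ζ) {φ : Ω → F} (hφ : Measurable φ) {R : ℝ} (hR : ∀ x, ‖φ x‖ ≤ R) :
    Integrable (fun x => empRisk ℓ (ζ x) (φ x)) μ :=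
  (integrable_finsetSum _ fun i _ =>
    h.integrable_loss_comp μ ((measurable_pi_apply i).comp hζ) hφ hR).const_mul _

/-- A fresh uniform index turns the loss into the empirical risk. -/
theorem integral_loss_index (h : IsNonexpansiveSubgradient ℓ g η G M) {m : ℕ} [NeZero m]
    (z : Fin m → Z) (k : ℕ) {φ : (ℕ → Fin m) → F} (hφ : Measurable φ) {R : ℝ}
    (hR : ∀ j, ‖φ j‖ ≤ R) (hk : ∀ j i, φ (Function.update j k i) = φ j) :
    ∫ j, ℓ (z (j k)) (φ j) ∂indexLaw m = ∫ j, empRisk ℓ z (φ j) ∂indexLaw m := by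
  have hint := h.integrable_loss_comp (indexLaw m) (measurable_sample_eval z k) hφ hR
  unfold indexLaw at hint ⊢
  rw [integral_infinitePi_update _ k hint]
  refine integral_congr_ae (Filter.Eventually.of_forall fun j => ?_)
  simp only [hk, Function.update_self]
  exact integral_uniformOfFintype_fin fun i => ℓ (z i) (φ j)

/-- The comparator may depend on the indices before `s`, since every index drawn from time `s` on is
still fresh for it. This admits both a constant and the iterate at time `s`. -/
theorem sum_integral_empRisk_sub_le (h : IsNonexpansiveSubgradient ℓ g η G M) {m : ℕ} [NeZero m]
    (z : Fin m → Z) {s : ℕ} (hs : 1 ≤ s) {φ : (ℕ → Fin m) → F} (hφ : Measurable φ) {R : ℝ}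
    (hR : ∀ j, ‖φ j‖ ≤ R) (hk : ∀ k, s ≤ k → ∀ j i, φ (Function.update j k i) = φ j) (n : ℕ) :
    2 * η * ∑ k ∈ Finset.Ico s (s + n), (∫ j, empRisk ℓ z (sgd g η z j k) ∂indexLaw m -
        ∫ j, empRisk ℓ z (φ j) ∂indexLaw m) ≤
      ∫ j, ‖sgd g η z j s - φ j‖ ^ 2 ∂indexLaw m + n * (η * G) ^ 2 := by
  have hsq : ∀ k, Integrable (fun j => ‖sgd g η z j k - φ j‖ ^ 2) (indexLaw m) := fun k => by
    have hm : Measurable fun j => sgd g η z j k - φ j := (h.measurable_sgd_index z k).sub hφ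
    refine integrable_of_abs_le (hm.norm.pow_const 2) (c := (η * G * k + R) ^ 2) fun j => ?_
    rw [abs_of_nonneg (sq_nonneg _)]
    exact pow_le_pow_left₀ (norm_nonneg _)
      ((norm_sub_le _ _).trans (add_le_add (h.norm_sgd_le z j k) (hR j))) 2
  -- The final squared distance must stay on the left for the sum to telescope; it is dropped
  -- afterwards.
  suffices H : ∀ n : ℕ, ∫ j, ‖sgd g η z j (s + n) - φ j‖ ^ 2 ∂indexLaw m +
      2 * η * ∑ k ∈ Finset.Ico s (s + n), (∫ j, empRisk ℓ z (sgd g η z j k) ∂indexLaw m -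
        ∫ j, empRisk ℓ z (φ j) ∂indexLaw m) ≤
      ∫ j, ‖sgd g η z j s - φ j‖ ^ 2 ∂indexLaw m + n * (η * G) ^ 2 by
    have h0 : 0 ≤ ∫ j, ‖sgd g η z j (s + n) - φ j‖ ^ 2 ∂indexLaw m :=
      integral_nonneg fun j => sq_nonneg _
    linarith [H n]
  intro n
  induction n with
  | zero => simp
  | succ n ih =>
    have h1 := h.integrable_loss_comp (indexLaw m) (measurable_sample_eval z (s + n))
      (h.measurable_sgd_index z (s + n)) (fun j => h.norm_sgd_le z j (s + n))
    have h2 := h.integrable_loss_comp (indexLaw m) (measurable_sample_eval z (s + n)) hφ hR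
    have e1 := h.integral_loss_index z (s + n) (h.measurable_sgd_index z (s + n))
      (fun j => h.norm_sgd_le z j (s + n)) (fun j i => sgd_update_index z j _ i _ le_rfl)
    have e2 := h.integral_loss_index z (s + n) hφ hR (hk _ (by omega))
    have i2 : Integrable (fun j => 2 * η * (ℓ (z (j (s + n))) (sgd g η z j (s + n)) -
        ℓ (z (j (s + n))) (φ j))) (indexLaw m) := (h1.sub h2).const_mul _
    have i3 : Integrable (fun j => ‖sgd g η z j (s + n) - φ j‖ ^ 2 + (η * G) ^ 2) (indexLaw m) :=
      (hsq _).add (integrable_const _)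
    have h3 : ∫ j, ‖sgd g η z j (s + (n + 1)) - φ j‖ ^ 2 ∂indexLaw m ≤
        ∫ j, (‖sgd g η z j (s + n) - φ j‖ ^ 2 + (η * G) ^ 2 -
          2 * η * (ℓ (z (j (s + n))) (sgd g η z j (s + n)) - ℓ (z (j (s + n))) (φ j)))
            ∂indexLaw m :=
      integral_mono (hsq _) (i3.sub i2)
        fun j => h.norm_sgd_succ_sub_sq_le z j (hs.trans (Nat.le_add_right s n)) (φ j)
    rw [integral_sub i3 i2,
      integral_add (hsq _) (integrable_const _), integral_const_mul, integral_sub h1 h2, e1, e2,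
      integral_const, probReal_univ, one_smul] at h3
    rw [← add_assoc s n 1, Finset.sum_Ico_succ_top (by omega), add_assoc s n 1]
    push_cast
    linarith

/-- Expected empirical risk of the average of the iterates. -/
theorem sum_integral_empRisk_le (h : IsNonexpansiveSubgradient ℓ g η G M) {m : ℕ} [NeZero m]
    (z : Fin m → Z) (u : F) (t : ℕ) :
    ∑ k ∈ Finset.Icc 1 t, ∫ j, empRisk ℓ z (sgd g η z j k) ∂indexLaw m ≤
      t * empRisk ℓ z u + ‖u‖ ^ 2 / (2 * η) + t * (η * G ^ 2 / 2) := by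
  have h1 := h.sum_integral_empRisk_sub_le z (s := 1) le_rfl (φ := fun _ => u) measurable_const
    (R := ‖u‖) (fun _ => le_rfl) (fun _ _ _ _ => rfl) t
  have hI : Finset.Ico 1 (1 + t) = Finset.Icc 1 t := by ext; simp; omega
  simp only [sgd_one, zero_sub, norm_neg, integral_const, probReal_univ, one_smul,
    Finset.sum_sub_distrib, Finset.sum_const, hI, Nat.card_Icc, Nat.add_sub_cancel,
    nsmul_eq_mul] at h1
  have hη := h.step_pos
  refine le_of_mul_le_mul_left ?_ (by linarith : 0 < 2 * η)
  have e : 2 * η * (t * empRisk ℓ z u + ‖u‖ ^ 2 / (2 * η) + t * (η * G ^ 2 / 2)) =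
      2 * η * (t * empRisk ℓ z u) + ‖u‖ ^ 2 + t * (η * G) ^ 2 := by
    field_simp
  rw [e]
  linarith

/-- Expected empirical risk of the last iterate. -/
theorem integral_empRisk_last_le (h : IsNonexpansiveSubgradient ℓ g η G M) {m : ℕ} [NeZero m]
    (z : Fin m → Z) (u : F) {t : ℕ} (ht : 1 ≤ t) :
    ∫ j, empRisk ℓ z (sgd g η z j t) ∂indexLaw m ≤
      empRisk ℓ z u + ‖u‖ ^ 2 / (2 * (η * t)) +
        η * G ^ 2 / 2 * (1 + (harmonic (t - 1) : ℝ)) := by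
  obtain ⟨t, rfl⟩ := Nat.exists_eq_add_of_le' ht
  set a : ℕ → ℝ := fun k => ∫ j, empRisk ℓ z (sgd g η z j k) ∂indexLaw m with ha
  have hη := h.step_pos
  have refl_sum : ∀ k < t + 1, ∑ i ∈ Finset.range (k + 1), a (t + 1 - i) =
      ∑ i ∈ Finset.Ico (t + 1 - k) (t + 1 - k + (k + 1)), a i := fun k hk => by
    rw [Finset.range_eq_Ico, Finset.sum_Ico_reflect a 0 (by omega)]
    congr 2 <;> omega
  -- The comparator is the first iterate of each suffix, so the initial distance vanishes and the
  -- suffix average exceeds its first term by at most `η * G ^ 2 / 2`.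
  have key := head_le_average_add_harmonic (fun i => a (t + 1 - i)) (η * G ^ 2 / 2) (t + 1)
    (fun k hk => by
      have h1 := h.sum_integral_empRisk_sub_le z (s := t + 1 - k) (by omega)
        (h.measurable_sgd_index z (t + 1 - k)) (fun j => h.norm_sgd_le z j _)
        (fun i hi j i' => sgd_update_index z j i i' _ hi) (k + 1)
      simp only [sub_self, norm_zero, Finset.sum_sub_distrib, Finset.sum_const, Nat.card_Ico,
        Nat.add_sub_cancel_left, nsmul_eq_mul] at h1
      rw [refl_sum k hk]
      refine le_of_mul_le_mul_left ?_ (by linarith : 0 < 2 * η)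
      simp only [ha]
      push_cast at h1
      simp at h1
      nlinarith) t (by omega)
  have havg := h.sum_integral_empRisk_le z u (t + 1)
  have e1 : ∑ i ∈ Finset.range (t + 1), a (t + 1 - i) = ∑ k ∈ Finset.Icc 1 (t + 1), a k := by
    rw [refl_sum t (by omega)]
    congr 1
    ext; simp; omega
  rw [e1] at key
  have ht0 : (0 : ℝ) < t + 1 := by positivity
  have h2 := (div_le_div_iff_of_pos_right ht0).2 havg
  have e2 : (((t + 1 : ℕ) : ℝ) * empRisk ℓ z u + ‖u‖ ^ 2 / (2 * η) +
      ((t + 1 : ℕ) : ℝ) * (η * G ^ 2 / 2)) / (t + 1) =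
      empRisk ℓ z u + ‖u‖ ^ 2 / (2 * (η * ((t + 1 : ℕ) : ℝ))) + η * G ^ 2 / 2 := by
    push_cast
    field_simp
  rw [e2] at h2
  simp only [Nat.sub_zero] at key
  rw [Nat.add_sub_cancel]
  linarith

end IsNonexpansiveSubgradient

end Expectation

/-! ### Generalization by stability -/

section Generalization

variable {Z F : Type*} [MeasurableSpace Z] [NormedAddCommGroup F] [InnerProductSpace ℝ F]
  [MeasurableSpace F] [BorelSpace F] [SecondCountableTopology F]
  {ℓ : Z → F → ℝ} {g : Z → F → F} {η G M : ℝ} (ρ : Measure Z) [IsProbabilityMeasure ρ]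

/-- The average of the first `t` iterates. -/
def sgdAverage (g : Z → F → F) (η : ℝ) {m : ℕ} (z : Fin m → Z) (j : ℕ → Fin m) (t : ℕ) : F :=
  (t : ℝ)⁻¹ • ∑ k ∈ Finset.Icc 1 t, sgd g η z j k

namespace IsNonexpansiveSubgradient

theorem integrable_loss (h : IsNonexpansiveSubgradient ℓ g η G M) (w : F) :
    Integrable (fun z => ℓ z w) ρ :=
  h.integrable_loss_comp ρ measurable_id measurable_const (fun _ => le_rfl)

theorem abs_popRisk_sub_le (h : IsNonexpansiveSubgradient ℓ g η G M) (w v : F) :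
    |popRisk ρ ℓ w - popRisk ρ ℓ v| ≤ G * ‖w - v‖ := by
  unfold popRisk
  rw [← integral_sub (h.integrable_loss ρ w) (h.integrable_loss ρ v)]
  have := norm_integral_le_of_norm_le_const (μ := ρ) (f := fun z => ℓ z w - ℓ z v)
    (Filter.Eventually.of_forall fun z => h.abs_loss_sub_le z w v)
  simpa using this

theorem abs_popRisk_le (h : IsNonexpansiveSubgradient ℓ g η G M) {w : F} {R : ℝ}
    (hw : ‖w‖ ≤ R) : |popRisk ρ ℓ w| ≤ M + G * R := by
  have := norm_integral_le_of_norm_le_const (μ := ρ) (f := fun z => ℓ z w)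
    (Filter.Eventually.of_forall fun z => h.abs_loss_le z hw)
  simpa [popRisk] using this

theorem continuous_popRisk (h : IsNonexpansiveSubgradient ℓ g η G M) :
    Continuous (popRisk ρ ℓ) := by
  refine (LipschitzWith.of_dist_le_mul (K := ⟨G, h.bound_nonneg⟩) fun w v => ?_).continuous
  rw [Real.dist_eq, dist_eq_norm]
  exact h.abs_popRisk_sub_le ρ w v

theorem integrable_popRisk_comp (h : IsNonexpansiveSubgradient ℓ g η G M) {Ω : Type*}
    [MeasurableSpace Ω] (μ : Measure Ω) [IsFiniteMeasure μ] {φ : Ω → F} (hφ : Measurable φ)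
    {R : ℝ} (hR : ∀ x, ‖φ x‖ ≤ R) : Integrable (fun x => popRisk ρ ℓ (φ x)) μ :=
  integrable_of_abs_le ((h.continuous_popRisk ρ).measurable.comp hφ)
    fun x => h.abs_popRisk_le ρ (hR x)

/-- A learning rule which is stable under replacement of the `i`-th sample point has almost the
same expected loss on that point and on a fresh one. -/
theorem integral_popRisk_sub_loss_le (h : IsNonexpansiveSubgradient ℓ g η G M) {m : ℕ}
    {φ : (Fin m → Z) → F} (hφ : Measurable φ) {R : ℝ} (hR : ∀ z, ‖φ z‖ ≤ R) (i : Fin m) {δ : ℝ}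
    (hδ : ∀ z a b, ‖φ (Function.update z i a) - φ (Function.update z i b)‖ ≤ δ) :
    ∫ z, (popRisk ρ ℓ (φ z) - ℓ (z i) (φ z)) ∂(Measure.pi fun _ : Fin m => ρ) ≤ G * δ := by
  rw [← Measure.infinitePi_eq_pi]
  have hint : Integrable (fun z : Fin m → Z => popRisk ρ ℓ (φ z) - ℓ (z i) (φ z))
      (Measure.infinitePi fun _ : Fin m => ρ) :=
    (h.integrable_popRisk_comp ρ _ hφ hR).sub
      (h.integrable_loss_comp _ (measurable_pi_apply i) hφ hR)
  rw [integral_infinitePi_update _ i hint]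
  have inner_le : ∀ z : Fin m → Z, ∫ a, (popRisk ρ ℓ (φ (Function.update z i a)) -
      ℓ (Function.update z i a i) (φ (Function.update z i a))) ∂ρ ≤ G * δ := fun z => by
    have hu : Measurable fun a => φ (Function.update z i a) := hφ.comp (measurable_update z)
    have hR' : ∀ a, ‖φ (Function.update z i a)‖ ≤ R := fun a => hR _
    have i1 := h.integrable_popRisk_comp ρ ρ hu hR'
    have i2 : Integrable (fun a => ℓ a (φ (Function.update z i a))) ρ :=
      h.integrable_loss_comp ρ measurable_id hu hR'
    have i3 : Integrable (Function.uncurry fun a b => ℓ b (φ (Function.update z i a)))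
        (ρ.prod ρ) :=
      h.integrable_loss_comp (ρ.prod ρ) measurable_snd (hu.comp measurable_fst) fun p => hR' p.1
    -- Training point and test point are i.i.d., so they may exchange roles. Both losses are then
    -- evaluated at the same point `a`, and only the training point differs.
    have e : ∫ a, popRisk ρ ℓ (φ (Function.update z i a)) ∂ρ =
        ∫ a, ∫ b, ℓ a (φ (Function.update z i b)) ∂ρ ∂ρ := integral_integral_swap i3
    have i4 : Integrable (fun a => ∫ b, ℓ a (φ (Function.update z i b)) ∂ρ) ρ :=
      i3.integral_prod_right
    simp only [Function.update_self]
    rw [integral_sub i1 i2, e, ← integral_sub i4 i2]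
    have hle : ∀ a, (∫ b, ℓ a (φ (Function.update z i b)) ∂ρ) - ℓ a (φ (Function.update z i a)) ≤
        G * δ := fun a => by
      have i5 : Integrable (fun b => ℓ a (φ (Function.update z i b))) ρ :=
        h.integrable_loss_comp ρ measurable_const hu hR'
      have := integral_mono i5 (integrable_const (ℓ a (φ (Function.update z i a)) + G * δ))
        fun b => by
          have h1 := (abs_le.1 (h.abs_loss_sub_le a (φ (Function.update z i b))
            (φ (Function.update z i a)))).2
          have h2 := mul_le_mul_of_nonneg_left (hδ z b a) h.bound_nonneg
          show ℓ a (φ (Function.update z i b)) ≤ ℓ a (φ (Function.update z i a)) + G * δ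
          linarith
      simp only [integral_const, probReal_univ, one_smul] at this
      linarith
    have := integral_mono (i4.sub i2) (integrable_const (G * δ)) hle
    simpa using this
  have hint' : Integrable (fun z : Fin m → Z => ∫ a, (popRisk ρ ℓ (φ (Function.update z i a)) -
      ℓ (Function.update z i a i) (φ (Function.update z i a))) ∂ρ)
      (Measure.infinitePi fun _ : Fin m => ρ) :=
    ((measurePreserving_update_infinitePi (fun _ : Fin m => ρ) i).integrable_comp_of_integrable
      hint).integral_prod_left
  have := integral_mono hint' (integrable_const (G * δ)) inner_le
  simpa using this

/-- The expected generalization gap of the `t`-th iterate, for fixed indices. -/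
theorem integral_popRisk_sub_empRisk_le (h : IsNonexpansiveSubgradient ℓ g η G M) {m : ℕ}
    [NeZero m] (j : ℕ → Fin m) (t : ℕ) :
    ∫ z, (popRisk ρ ℓ (sgd g η z j t) - empRisk ℓ z (sgd g η z j t))
      ∂(Measure.pi fun _ : Fin m => ρ) ≤ 2 * η * G ^ 2 * t / m := by
  have hm : (m : ℝ) ≠ 0 := NeZero.ne _
  have hmeas := h.measurable_sgd_sample j t
  have hR : ∀ z : Fin m → Z, ‖sgd g η z j t‖ ≤ η * G * t := fun z => h.norm_sgd_le z j t
  have e : ∀ z : Fin m → Z, popRisk ρ ℓ (sgd g η z j t) - empRisk ℓ z (sgd g η z j t) =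
      (m : ℝ)⁻¹ * ∑ i, (popRisk ρ ℓ (sgd g η z j t) - ℓ (z i) (sgd g η z j t)) := fun z => by
    rw [Finset.sum_sub_distrib, Finset.sum_const, Finset.card_univ, Fintype.card_fin,
      nsmul_eq_mul, empRisk]
    field_simp
  have hint : ∀ i : Fin m, Integrable (fun z : Fin m → Z =>
      popRisk ρ ℓ (sgd g η z j t) - ℓ (z i) (sgd g η z j t)) (Measure.pi fun _ : Fin m => ρ) :=
    fun i => (h.integrable_popRisk_comp ρ _ hmeas hR).sub
      (h.integrable_loss_comp _ (measurable_pi_apply i) hmeas hR)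
  simp only [e]
  rw [integral_const_mul, integral_finsetSum _ fun i _ => hint i]
  -- Each time draws exactly one sample point. The unused index `j 0` is counted too, which only
  -- loosens the bound.
  have hsum : ∑ i : Fin m, ∑ k ∈ Finset.range t, (if j k = i then (1 : ℝ) else 0) = t := by
    rw [Finset.sum_comm]; simp
  calc _ ≤ (m : ℝ)⁻¹ * ∑ i : Fin m,
        G * (2 * η * G * ∑ k ∈ Finset.range t, if j k = i then 1 else 0) :=
        mul_le_mul_of_nonneg_left (Finset.sum_le_sum fun i _ =>
          h.integral_popRisk_sub_loss_le ρ hmeas hR i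
            fun z a b => h.norm_sgd_update_sub_le z i a b j t) (by positivity)
    _ = _ := by
        rw [← Finset.mul_sum, ← Finset.mul_sum, hsum]
        field_simp

/-- Jensen's inequality: the subgradient inequalities at the average are summed, and their linear
terms cancel. -/
theorem popRisk_sgdAverage_le (h : IsNonexpansiveSubgradient ℓ g η G M) {m : ℕ} (z : Fin m → Z)
    (j : ℕ → Fin m) {t : ℕ} (ht : 1 ≤ t) :
    popRisk ρ ℓ (sgdAverage g η z j t) ≤
      (t : ℝ)⁻¹ * ∑ k ∈ Finset.Icc 1 t, popRisk ρ ℓ (sgd g η z j k) := by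
  have ht0 : (t : ℝ) ≠ 0 := by positivity
  unfold popRisk
  rw [← integral_finsetSum _ fun k _ => h.integrable_loss ρ _, ← integral_const_mul]
  refine integral_mono (h.integrable_loss ρ _)
    ((integrable_finsetSum _ fun k _ => h.integrable_loss ρ _).const_mul _) fun y => ?_
  set w := sgdAverage g η z j t
  have hw : ∑ k ∈ Finset.Icc 1 t, sgd g η z j k = (t : ℝ) • w := by
    simp only [w, sgdAverage]; rw [smul_inv_smul₀ ht0]
  have hs := Finset.sum_le_sum fun k (_ : k ∈ Finset.Icc 1 t) =>
    h.subgradient y w (sgd g η z j k)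
  have hz : ∑ k ∈ Finset.Icc 1 t, inner ℝ (g y w) (sgd g η z j k - w) = 0 := by
    rw [← inner_sum, Finset.sum_sub_distrib, hw, Finset.sum_const, Nat.card_Icc,
      Nat.add_sub_cancel, ← Nat.cast_smul_eq_nsmul ℝ, sub_self, inner_zero_right]
  rw [Finset.sum_add_distrib, hz, Finset.sum_const, Nat.card_Icc, Nat.add_sub_cancel,
    nsmul_eq_mul, add_zero] at hs
  show ℓ y w ≤ (t : ℝ)⁻¹ * _
  rw [← div_eq_inv_mul, le_div_iff₀ (by positivity)]
  linarith

theorem measurable_sgdAverage (h : IsNonexpansiveSubgradient ℓ g η G M) {m : ℕ} (t : ℕ) :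
    Measurable fun p : (Fin m → Z) × (ℕ → Fin m) => sgdAverage g η p.1 p.2 t :=
  (Finset.measurable_fun_sum _ fun k _ => h.measurable_sgd k).const_smul _

theorem norm_sgdAverage_le (h : IsNonexpansiveSubgradient ℓ g η G M) {m : ℕ} (z : Fin m → Z)
    (j : ℕ → Fin m) {t : ℕ} (ht : 1 ≤ t) : ‖sgdAverage g η z j t‖ ≤ η * G * t := by
  have hb : ∀ k ∈ Finset.Icc 1 t, ‖sgd g η z j k‖ ≤ η * G * t := fun k hk =>
    (h.norm_sgd_le z j k).trans (mul_le_mul_of_nonneg_left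
      (by exact_mod_cast (Finset.mem_Icc.1 hk).2) (mul_nonneg h.step_pos.le h.bound_nonneg))
  have := norm_sum_le_of_le _ hb
  rw [Finset.sum_const, Nat.card_Icc, Nat.add_sub_cancel, nsmul_eq_mul] at this
  rw [sgdAverage, norm_smul, norm_inv, Real.norm_natCast, ← div_eq_inv_mul,
    div_le_iff₀ (by positivity)]
  linarith

variable {m : ℕ} [NeZero m]

theorem integral_empRisk_const (h : IsNonexpansiveSubgradient ℓ g η G M) (u : F) :
    ∫ z, empRisk ℓ z u ∂(Measure.pi fun _ : Fin m => ρ) = popRisk ρ ℓ u := by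
  have hm : (m : ℝ) ≠ 0 := NeZero.ne _
  have e : ∀ i : Fin m, ∫ z : Fin m → Z, ℓ (z i) u ∂(Measure.pi fun _ : Fin m => ρ) =
      popRisk ρ ℓ u := fun i => by
    have hp := measurePreserving_eval (fun _ : Fin m => ρ) i
    have := integral_map (μ := Measure.pi fun _ : Fin m => ρ) hp.measurable.aemeasurable
      (f := fun z => ℓ z u) (by
        rw [hp.map_eq]; exact (h.integrable_loss ρ u).aestronglyMeasurable)
    rw [hp.map_eq] at this
    exact this.symm
  unfold empRisk
  rw [integral_const_mul, integral_finsetSum _ fun i _ =>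
    h.integrable_loss_comp _ (measurable_pi_apply i) measurable_const (fun _ => le_rfl)]
  simp only [e, Finset.sum_const, Finset.card_univ, Fintype.card_fin, nsmul_eq_mul]
  field_simp

theorem integral_prod_popRisk_le (h : IsNonexpansiveSubgradient ℓ g η G M) (t : ℕ) :
    ∫ p, popRisk ρ ℓ (sgd g η p.1 p.2 t)
        ∂((Measure.pi fun _ : Fin m => ρ).prod (indexLaw m)) ≤
      ∫ z, ∫ j, empRisk ℓ z (sgd g η z j t) ∂indexLaw m ∂(Measure.pi fun _ : Fin m => ρ) +
        2 * η * G ^ 2 * t / m := by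
  have hR : ∀ p : (Fin m → Z) × (ℕ → Fin m), ‖sgd g η p.1 p.2 t‖ ≤ η * G * t :=
    fun p => h.norm_sgd_le p.1 p.2 t
  have i1 := h.integrable_popRisk_comp ρ
    ((Measure.pi fun _ : Fin m => ρ).prod (indexLaw m)) (h.measurable_sgd t) hR
  have i2 := h.integrable_empRisk ((Measure.pi fun _ : Fin m => ρ).prod (indexLaw m))
    measurable_fst (h.measurable_sgd t) hR
  have i3 : Integrable (fun p : (Fin m → Z) × (ℕ → Fin m) =>
      popRisk ρ ℓ (sgd g η p.1 p.2 t) - empRisk ℓ p.1 (sgd g η p.1 p.2 t))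
      ((Measure.pi fun _ : Fin m => ρ).prod (indexLaw m)) := i1.sub i2
  have e1 := integral_sub i1 i2
  -- Stability needs the indices fixed and the optimization bound needs the sample fixed, hence the
  -- two orders of integration.
  rw [integral_prod_symm _ i3, integral_prod _ i2] at e1
  have := integral_mono i3.integral_prod_right (integrable_const (2 * η * G ^ 2 * t / m))
    fun j => h.integral_popRisk_sub_empRisk_le ρ j t
  simp only [integral_const, probReal_univ, one_smul] at this
  linarith

theorem integrable_integral_empRisk (h : IsNonexpansiveSubgradient ℓ g η G M) (t : ℕ) :
    Integrable (fun z => ∫ j, empRisk ℓ z (sgd g η z j t) ∂indexLaw m)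
      (Measure.pi fun _ : Fin m => ρ) :=
  (h.integrable_empRisk ((Measure.pi fun _ : Fin m => ρ).prod (indexLaw m))
    measurable_fst (h.measurable_sgd t) fun p => h.norm_sgd_le p.1 p.2 t).integral_prod_left

theorem integral_popRisk_sgd_le (h : IsNonexpansiveSubgradient ℓ g η G M) (u : F) {t : ℕ}
    (ht : 1 ≤ t) :
    ∫ p, popRisk ρ ℓ (sgd g η p.1 p.2 t)
        ∂((Measure.pi fun _ : Fin m => ρ).prod (indexLaw m)) ≤
      popRisk ρ ℓ u + ‖u‖ ^ 2 / (2 * (η * t)) + η * G ^ 2 / 2 * (1 + (harmonic (t - 1) : ℝ)) +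
        2 * η * G ^ 2 * t / m := by
  refine (h.integral_prod_popRisk_le ρ t).trans (add_le_add_left ?_ _)
  have i1 : Integrable (fun z : Fin m → Z => empRisk ℓ z u) (Measure.pi fun _ : Fin m => ρ) :=
    h.integrable_empRisk _ measurable_id measurable_const fun _ => le_rfl
  have := integral_mono (h.integrable_integral_empRisk ρ t)
    (i1.add (integrable_const (‖u‖ ^ 2 / (2 * (η * t)) +
      η * G ^ 2 / 2 * (1 + (harmonic (t - 1) : ℝ))))) fun z => by
        have := h.integral_empRisk_last_le z u ht
        show _ ≤ empRisk ℓ z u + (_ + _)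
        linarith
  rw [integral_add' i1 (integrable_const _), h.integral_empRisk_const ρ] at this
  simp only [integral_const, probReal_univ, one_smul] at this
  linarith

theorem integral_popRisk_sgdAverage_le (h : IsNonexpansiveSubgradient ℓ g η G M) (u : F) {t : ℕ}
    (ht : 1 ≤ t) :
    ∫ p, popRisk ρ ℓ (sgdAverage g η p.1 p.2 t)
        ∂((Measure.pi fun _ : Fin m => ρ).prod (indexLaw m)) ≤
      popRisk ρ ℓ u + ‖u‖ ^ 2 / (2 * (η * t)) + η * G ^ 2 / 2 + 2 * η * G ^ 2 * t / m := by
  have hη := h.step_pos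
  have ht0 : (0 : ℝ) < t := by positivity
  have i0 : ∀ k, Integrable (fun p : (Fin m → Z) × (ℕ → Fin m) =>
      popRisk ρ ℓ (sgd g η p.1 p.2 k)) ((Measure.pi fun _ : Fin m => ρ).prod (indexLaw m)) :=
    fun k => h.integrable_popRisk_comp ρ _ (h.measurable_sgd k) fun p => h.norm_sgd_le p.1 p.2 k
  have h1 := integral_mono (h.integrable_popRisk_comp ρ
    ((Measure.pi fun _ : Fin m => ρ).prod (indexLaw m)) (h.measurable_sgdAverage t)
      fun p => h.norm_sgdAverage_le p.1 p.2 ht)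
    ((integrable_finsetSum _ fun k _ => i0 k).const_mul _)
    fun p => h.popRisk_sgdAverage_le ρ p.1 p.2 ht
  rw [integral_const_mul, integral_finsetSum _ fun k _ => i0 k] at h1
  have h2 : ∑ k ∈ Finset.Icc 1 t, ∫ p, popRisk ρ ℓ (sgd g η p.1 p.2 k)
        ∂((Measure.pi fun _ : Fin m => ρ).prod (indexLaw m)) ≤
      ∑ k ∈ Finset.Icc 1 t, (∫ z, ∫ j, empRisk ℓ z (sgd g η z j k) ∂indexLaw m
        ∂(Measure.pi fun _ : Fin m => ρ) + 2 * η * G ^ 2 * t / m) := by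
    refine Finset.sum_le_sum fun k hk => (h.integral_prod_popRisk_le ρ k).trans ?_
    have : (k : ℝ) ≤ t := by exact_mod_cast (Finset.mem_Icc.1 hk).2
    gcongr
  have i1 : Integrable (fun z : Fin m → Z => t * empRisk ℓ z u)
      (Measure.pi fun _ : Fin m => ρ) :=
    (h.integrable_empRisk _ measurable_id measurable_const fun _ => le_rfl).const_mul _
  have h3 := integral_mono (integrable_finsetSum _ fun k (_ : k ∈ Finset.Icc 1 t) =>
      h.integrable_integral_empRisk (m := m) ρ k)
    (i1.add (integrable_const (‖u‖ ^ 2 / (2 * η) + t * (η * G ^ 2 / 2)))) fun z => by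
      have := h.sum_integral_empRisk_le z u t
      show _ ≤ t * empRisk ℓ z u + (_ + _)
      linarith
  rw [integral_add' i1 (integrable_const _), integral_const_mul, h.integral_empRisk_const ρ,
    integral_finsetSum _ fun k _ => h.integrable_integral_empRisk ρ k] at h3
  simp only [integral_const, probReal_univ, one_smul] at h3
  rw [Finset.sum_add_distrib, Finset.sum_const, Nat.card_Icc, Nat.add_sub_cancel,
    nsmul_eq_mul] at h2
  refine h1.trans ?_
  rw [← div_eq_inv_mul, div_le_iff₀ ht0]
  have e : (popRisk ρ ℓ u + ‖u‖ ^ 2 / (2 * (η * t)) + η * G ^ 2 / 2 +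
      2 * η * G ^ 2 * t / m) * t = t * popRisk ρ ℓ u + ‖u‖ ^ 2 / (2 * η) +
        t * (η * G ^ 2 / 2) + t * (2 * η * G ^ 2 * t / m) := by
    field_simp
  rw [e]
  linarith

end IsNonexpansiveSubgradient

end Generalization

/-! ### Smooth convex functions of one variable -/

section ConvexDerivative

variable {f : ℝ → ℝ}

theorem add_deriv_mul_sub_le (hf : ConvexOn ℝ Set.univ f) (hd : Differentiable ℝ f) (a b : ℝ) :
    f a + deriv f a * (b - a) ≤ f b := by
  rcases lt_trichotomy a b with hab | rfl | hab
  · have := hf.deriv_le_slope (Set.mem_univ a) (Set.mem_univ b) hab (hd a)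
    rw [slope_def_field, le_div_iff₀ (sub_pos.2 hab)] at this
    linarith
  · simp
  · have := hf.slope_le_deriv (Set.mem_univ b) (Set.mem_univ a) hab (hd a)
    rw [slope_def_field, div_le_iff₀ (sub_pos.2 hab)] at this
    linarith

/-- Cocoercivity. In one dimension the derivative increment and `b - a` have the same sign, so the
Lipschitz bound can be multiplied by the increment. -/
theorem sq_deriv_sub_le (hf : ConvexOn ℝ Set.univ f) (hd : Differentiable ℝ f) {L : ℝ}
    (hL : ∀ a b, |deriv f b - deriv f a| ≤ L * |b - a|) (a b : ℝ) :
    (deriv f b - deriv f a) ^ 2 ≤ L * ((deriv f b - deriv f a) * (b - a)) := by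
  have h1 := add_deriv_mul_sub_le hf hd a b
  have h2 := add_deriv_mul_sub_le hf hd b a
  have h3 : 0 ≤ (deriv f b - deriv f a) * (b - a) := by linarith
  have h4 := mul_le_mul_of_nonneg_left (hL a b) (abs_nonneg (deriv f b - deriv f a))
  rw [← abs_of_nonneg h3, abs_mul, ← sq_abs]
  linarith

theorem leftDeriv_eq_deriv (hd : Differentiable ℝ f) (a : ℝ) : leftDeriv f a = deriv f a :=
  (hd a).derivWithin (uniqueDiffWithinAt_Iio a)

end ConvexDerivative

/-! ### The losses of the kernel model -/

section Model

variable {X F : Type*} [NormedAddCommGroup F] [InnerProductSpace ℝ F]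
  {Y : Set ℝ} {V : ℝ → ℝ → ℝ} {Φ : X → F}

/-- The loss `V(y, ⟨w, Φ x⟩)` at the point `z = (x, y)`. -/
def pointLoss (V : ℝ → ℝ → ℝ) (Φ : X → F) (z : X × Y) (w : F) : ℝ := V z.2 (inner ℝ w (Φ z.1))

/-- The gradient `V'_-(y, ⟨w, Φ x⟩) Φ x` at the point `z = (x, y)`. -/
def pointGrad (V : ℝ → ℝ → ℝ) (Φ : X → F) (z : X × Y) (w : F) : F :=
  leftDeriv (V z.2) (inner ℝ w (Φ z.1)) • Φ z.1

theorem iterate_eq_sgd {η : ℕ → ℝ} {c : ℝ} (hη : ∀ k, η k = c) {m : ℕ} (z : Fin m → X × Y)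
    (j : ℕ → Fin m) : ∀ t, iterate V Φ η z j t = sgd (pointGrad V Φ) c z j t
  | 0 => rfl
  | 1 => rfl
  | t + 2 => by
    rw [iterate, sgd_succ (t := t + 1) _ _ (by omega), iterate_eq_sgd hη z j (t + 1), hη, mul_smul]
    rfl

theorem averagedIterate_eq_sgdAverage {η : ℕ → ℝ} {c : ℝ} (hη : ∀ k, η k = c) (hc : c ≠ 0)
    {m : ℕ} (z : Fin m → X × Y) (j : ℕ → Fin m) (t : ℕ) :
    averagedIterate V Φ η z j t = sgdAverage (pointGrad V Φ) c z j t := by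
  simp only [averagedIterate, sgdAverage, hη, iterate_eq_sgd hη, ← Finset.smul_sum,
    Finset.sum_const, Nat.card_Icc, Nat.add_sub_cancel, nsmul_eq_mul, mul_inv, mul_smul]
  rw [inv_smul_smul₀ hc]

theorem IsSmoothLoss.measurable_leftDeriv {L : ℝ} (hs : IsSmoothLoss Y V L)
    (hV : IsConvexLoss Y V) : Measurable fun q : Y × ℝ => leftDeriv (V q.1) q.2 := by
  have hlim : Filter.Tendsto (fun n : ℕ => (1 : ℝ) / (n + 1)) Filter.atTop
      (nhdsWithin 0 {0}ᶜ) :=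
    tendsto_nhdsWithin_iff.2 ⟨tendsto_one_div_add_atTop_nhds_zero_nat,
      Filter.Eventually.of_forall fun n => by
        have : (1 : ℝ) / (n + 1) ≠ 0 := by positivity
        simpa using this⟩
  -- Joint measurability comes from a limit of forward difference quotients; differentiability makes
  -- their limit the left derivative.
  refine measurable_of_tendsto_metrizable (f := fun (n : ℕ) (q : Y × ℝ) =>
    ((1 : ℝ) / (n + 1))⁻¹ * (V q.1 (q.2 + 1 / (n + 1)) - V q.1 q.2)) (fun n => ?_)
    (tendsto_pi_nhds.2 fun q => ?_)
  · have h1 : Measurable fun q : Y × ℝ => V q.1 (q.2 + 1 / (n + 1)) :=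
      hV.measurable.comp ((measurable_subtype_coe.comp measurable_fst).prodMk
        (measurable_snd.add_const _))
    have h2 : Measurable fun q : Y × ℝ => V q.1 q.2 :=
      hV.measurable.comp ((measurable_subtype_coe.comp measurable_fst).prodMk measurable_snd)
    exact (h1.sub h2).const_mul _
  · rw [leftDeriv_eq_deriv (hs.differentiable _ q.1.2)]
    exact ((hs.differentiable _ q.1.2 q.2).hasDerivAt.tendsto_slope_zero).comp hlim

theorem isNonexpansiveSubgradient_pointLoss [MeasurableSpace X] [MeasurableSpace F] [BorelSpace F]
    [SecondCountableTopology F] [Nonempty (X × Y)] {a₀ κ L η : ℝ} (hΦ : Measurable Φ)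
    (hV : IsConvexLoss Y V) (hb : IsBounded Y V Φ a₀ κ) (hL : 0 < L) (hs : IsSmoothLoss Y V L)
    (hη : 0 < η) (hstep : η * (κ ^ 2 * L) ≤ 2) :
    ∃ M, IsNonexpansiveSubgradient (pointLoss (Y := Y) V Φ) (pointGrad V Φ) η (a₀ * κ) M := by
  obtain ⟨M, hM⟩ := hb.loss_zero
  obtain ⟨x₀, y₀⟩ := ‹Nonempty (X × Y)›
  have hκ : ∀ x, ‖Φ x‖ ≤ κ := fun x => by
    rw [norm_eq_sqrt_real_inner]; exact hb.feature.1 ⟨x, rfl⟩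
  have hκ0 : 0 ≤ κ := (norm_nonneg _).trans (hκ x₀)
  have ha0 : 0 ≤ a₀ := (abs_nonneg _).trans (hb.leftDeriv_le y₀ y₀.2 0)
  have hcoord : Measurable fun p : (X × Y) × F => (inner ℝ p.2 (Φ p.1.1) : ℝ) :=
    measurable_snd.inner (hΦ.comp (measurable_fst.comp measurable_fst))
  have hlabel : Measurable fun p : (X × Y) × F => p.1.2 := measurable_snd.comp measurable_fst
  refine ⟨M, ?_, ?_, hη, mul_nonneg ha0 hκ0, fun z w => hV.nonneg _ _, fun z => ?_,
    fun z w => ?_, fun z w v => ?_, fun z w v => ?_⟩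
  · exact hV.measurable.comp ((measurable_subtype_coe.comp hlabel).prodMk hcoord)
  · exact ((hs.measurable_leftDeriv hV).comp (hlabel.prodMk hcoord)).smul
      (hΦ.comp (measurable_fst.comp measurable_fst))
  · rw [pointLoss, inner_zero_left]
    exact hM ⟨z.2, z.2.2, rfl⟩
  · rw [pointGrad, norm_smul, Real.norm_eq_abs]
    exact mul_le_mul (hb.leftDeriv_le _ z.2.2 _) (hκ _) (norm_nonneg _) ha0
  · rw [pointGrad, leftDeriv_eq_deriv (hs.differentiable _ z.2.2), real_inner_smul_left,
      real_inner_comm (v - w), inner_sub_left]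
    exact add_deriv_mul_sub_le (hV.convex _ z.2.2) (hs.differentiable _ z.2.2) _ _
  · rw [pointGrad, pointGrad, leftDeriv_eq_deriv (hs.differentiable _ z.2.2),
      leftDeriv_eq_deriv (hs.differentiable _ z.2.2)]
    have key := sq_deriv_sub_le (hV.convex _ z.2.2) (hs.differentiable _ z.2.2)
      (hs.lipschitz _ z.2.2) (inner ℝ v (Φ z.1)) (inner ℝ w (Φ z.1))
    rw [← inner_sub_left] at key
    set d := deriv (V z.2) (inner ℝ w (Φ z.1)) - deriv (V z.2) (inner ℝ v (Φ z.1)) with hd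
    set s : ℝ := inner ℝ (w - v) (Φ z.1)
    have e : w - η • deriv (V z.2) (inner ℝ w (Φ z.1)) • Φ z.1 -
        (v - η • deriv (V z.2) (inner ℝ v (Φ z.1)) • Φ z.1) = (w - v) - (η * d) • Φ z.1 := by
      rw [hd, mul_sub, sub_smul, mul_smul, mul_smul]; abel
    rw [e]
    refine le_of_sq_le_sq ?_ (norm_nonneg _)
    rw [norm_sub_sq_real, inner_smul_right, norm_smul, mul_pow, Real.norm_eq_abs, sq_abs]
    have h1 : ‖Φ z.1‖ ^ 2 ≤ κ ^ 2 := pow_le_pow_left₀ (norm_nonneg _) (hκ _) 2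
    have h2 : 0 ≤ d * s := by
      by_contra hneg
      nlinarith [sq_nonneg d, mul_pos hL (neg_pos.2 (not_le.1 hneg))]
    -- Cocoercivity and the step-size condition let the cross term absorb the quadratic term of the
    -- expanded square.
    have h3 : (η * d) ^ 2 * ‖Φ z.1‖ ^ 2 ≤ 2 * (η * (d * s)) :=
      calc (η * d) ^ 2 * ‖Φ z.1‖ ^ 2 ≤ (η * d) ^ 2 * κ ^ 2 := by gcongr
        _ = (η ^ 2 * κ ^ 2) * d ^ 2 := by ring
        _ ≤ (η ^ 2 * κ ^ 2) * (L * (d * s)) := by gcongr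
        _ = (η * (κ ^ 2 * L)) * (η * (d * s)) := by ring
        _ ≤ 2 * (η * (d * s)) :=
            mul_le_mul_of_nonneg_right hstep (mul_nonneg hη.le h2)
    linarith

end Model

/-! ### From a fixed comparator to the approximation error -/

section ExcessRisk

variable {X F : Type*} [MeasurableSpace X] [NormedAddCommGroup F] [InnerProductSpace ℝ F]
  {Y : Set ℝ} (ρ : Measure (X × Y)) {V : ℝ → ℝ → ℝ} {Φ : X → F}

theorem sub_iInf_risk_le_approxError {l E B : ℝ}
    (hE : ∀ u, E ≤ risk ρ V Φ u + l / 2 * ‖u‖ ^ 2 + B) :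
    E - ⨅ v, risk ρ V Φ v ≤ approxError ρ V Φ l + B := by
  have := le_ciInf fun u => sub_le_iff_le_add.2 (hE u)
  unfold approxError
  linarith

instance [IsProbabilityMeasure ρ] (m : ℕ) [NeZero m] : IsProbabilityMeasure (law ρ m) := by
  unfold law; infer_instance

theorem expectedExcessRiskLE_of_le [IsProbabilityMeasure ρ] {m : ℕ} [NeZero m] {l B C : ℝ}
    {γ : (Fin m → X × Y) → (ℕ → Fin m) → F}
    (hint : Integrable (fun p : (Fin m → X × Y) × (ℕ → Fin m) => risk ρ V Φ (γ p.1 p.2))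
      (law ρ m))
    (hE : ∀ u, ∫ p, risk ρ V Φ (γ p.1 p.2) ∂law ρ m ≤ risk ρ V Φ u + l / 2 * ‖u‖ ^ 2 + B)
    (hC : approxError ρ V Φ l + B ≤ C) :
    ExpectedExcessRiskLE ρ V Φ m γ C := by
  refine ⟨hint.sub (integrable_const _), ?_⟩
  unfold excessRisk
  rw [integral_sub hint (integrable_const _), integral_const, probReal_univ, one_smul]
  exact (sub_iInf_risk_le_approxError ρ hE).trans hC

variable {ρ} in
theorem ExpectedExcessRiskLE.mono {m : ℕ} [NeZero m] {γ : (Fin m → X × Y) → (ℕ → Fin m) → F}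
    {B C : ℝ} (h : ExpectedExcessRiskLE ρ V Φ m γ B) (hBC : B ≤ C) :
    ExpectedExcessRiskLE ρ V Φ m γ C := ⟨h.1, h.2.trans hBC⟩

end ExcessRisk

/-! ### Excess risk for a general step-size -/

section Rates

variable {X F : Type*} [MeasurableSpace X] [NormedAddCommGroup F] [InnerProductSpace ℝ F]
  [MeasurableSpace F] [BorelSpace F] [SecondCountableTopology F]
  {Y : Set ℝ} (ρ : Measure (X × Y)) [IsProbabilityMeasure ρ] {V : ℝ → ℝ → ℝ} {Φ : X → F}

/-- The excess risk bound for both outputs, before inserting the step-size. -/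
theorem expectedExcessRiskLE_sgd {a₀ κ η M D : ℝ}
    (h : IsNonexpansiveSubgradient (pointLoss (Y := Y) V Φ) (pointGrad V Φ) η (a₀ * κ) M)
    {m : ℕ} [NeZero m] {γ : (Fin m → X × Y) → (ℕ → Fin m) → ℕ → F}
    (hγ : γ = sgdAverage (pointGrad V Φ) η ∨ γ = sgd (pointGrad V Φ) η) {t : ℕ} (ht : 1 ≤ t)
    (hD : approxError ρ V Φ (η * t)⁻¹ ≤ D) :
    ExpectedExcessRiskLE ρ V Φ m (fun z j => γ z j t)
      (D + (η * (a₀ * κ) ^ 2 / 2 * (1 + (harmonic (t - 1) : ℝ)) +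
        2 * η * (a₀ * κ) ^ 2 * t / m)) := by
  have hH : (0 : ℝ) ≤ harmonic (t - 1) := by
    exact_mod_cast Finset.sum_nonneg fun i _ => by positivity
  have hη := h.step_pos
  have e : ∀ u : F, (η * t)⁻¹ / 2 * ‖u‖ ^ 2 = ‖u‖ ^ 2 / (2 * (η * t)) := fun u => by
    have : (t : ℝ) ≠ 0 := by positivity
    field_simp
  refine expectedExcessRiskLE_of_le ρ (l := (η * t)⁻¹) ?_ (fun u => ?_) (add_le_add_left hD _)
  · rcases hγ with rfl | rfl
    · exact h.integrable_popRisk_comp ρ _ (h.measurable_sgdAverage t)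
        fun p => h.norm_sgdAverage_le p.1 p.2 ht
    · exact h.integrable_popRisk_comp ρ _ (h.measurable_sgd t) fun p => h.norm_sgd_le p.1 p.2 t
  · rw [e]
    rcases hγ with rfl | rfl
    · refine (h.integral_popRisk_sgdAverage_le ρ u ht).trans ?_
      -- The average needs no harmonic term; it is added so that one bound covers both outputs.
      have h1 : 0 ≤ η * (a₀ * κ) ^ 2 / 2 * (harmonic (t - 1) : ℝ) := by positivity
      show popRisk ρ (pointLoss V Φ) u + _ + _ + _ ≤ popRisk ρ (pointLoss V Φ) u + _ + _
      linarith
    · refine (h.integral_popRisk_sgd_le ρ u ht).trans ?_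
      show popRisk ρ (pointLoss V Φ) u + _ + _ + _ ≤ popRisk ρ (pointLoss V Φ) u + _ + _
      linarith

/-- Handles `t = 1`, where `log t = 0` leaves only the third term of the rate. The Lipschitz bound
and `G * ‖u‖ ≤ ‖u‖ ^ 2 / 2 + G ^ 2 / 2` suffice for the zero vector. -/
theorem expectedExcessRiskLE_zero {a₀ κ η M D : ℝ}
    (h : IsNonexpansiveSubgradient (pointLoss (Y := Y) V Φ) (pointGrad V Φ) η (a₀ * κ) M)
    {m : ℕ} [NeZero m] (hD : approxError ρ V Φ 1 ≤ D) :
    ExpectedExcessRiskLE ρ V Φ m (fun _ _ => 0) (D + (a₀ * κ) ^ 2 / 2) := by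
  refine expectedExcessRiskLE_of_le ρ (integrable_const _) (fun u => ?_) (add_le_add_left hD _)
  rw [integral_const, probReal_univ, one_smul]
  have h1 := (abs_le.1 (h.abs_popRisk_sub_le ρ 0 u)).2
  rw [zero_sub, norm_neg] at h1
  show popRisk ρ (pointLoss V Φ) 0 ≤ popRisk ρ (pointLoss V Φ) u + _ + _
  nlinarith [sq_nonneg (‖u‖ - a₀ * κ)]

end Rates

/-! ### Inserting the step-size -/

theorem one_half_le_log {t : ℕ} (ht : 2 ≤ t) : 1 / 2 ≤ Real.log t := by
  have h1 : Real.log 2 ≤ Real.log t := Real.log_le_log (by norm_num) (by exact_mod_cast ht)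
  linarith [Real.log_two_gt_d9]

theorem one_add_harmonic_le {t : ℕ} (ht : 2 ≤ t) :
    1 + (harmonic (t - 1) : ℝ) ≤ 5 * Real.log t := by
  have h1 := harmonic_le_one_add_log (t - 1)
  have h2 : Real.log ((t - 1 : ℕ) : ℝ) ≤ Real.log t :=
    Real.log_le_log (by exact_mod_cast (by omega : 0 < t - 1)) (by exact_mod_cast Nat.sub_le t 1)
  linarith [one_half_le_log ht]

/-- The three error terms for the step-size `η₁ m ^ (-β / (β + 1))`. -/
theorem error_terms_le {β c η₁ G : ℝ} (hβ : 0 < β) (hη₁ : 0 < η₁) (hc : 0 < c)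
    {m t : ℕ} (hm : 1 ≤ m) (ht : 2 ≤ t) {η : ℝ} (hη : η = η₁ * (m : ℝ) ^ (-(β / (β + 1)))) :
    c * ((η * t)⁻¹) ^ β + (η * G ^ 2 / 2 * (1 + (harmonic (t - 1) : ℝ)) + 2 * η * G ^ 2 * t / m) ≤
      (c + G ^ 2 + 4 * η₁ * G ^ 2 + c * η₁ ^ (-β)) *
        ((m : ℝ) ^ (-((2 * β + 1) / (β + 1))) * (t : ℝ) * Real.log t +
          (m : ℝ) ^ (-(β / (β + 1))) * Real.log t +
          (m : ℝ) ^ (β ^ 2 / (β + 1)) * (t : ℝ) ^ (-β)) := by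
  have hm0 : (0 : ℝ) < m := by positivity
  have ht0 : (0 : ℝ) < t := by positivity
  have hlog := one_half_le_log ht
  have hlog0 : 0 < Real.log t := by linarith
  have hη0 : 0 < η := by rw [hη]; positivity
  have hpow : (m : ℝ) ^ (-((2 * β + 1) / (β + 1))) = (m : ℝ) ^ (-(β / (β + 1))) / m := by
    rw [← Real.rpow_sub_one hm0.ne']
    congr 1
    field_simp
    ring
  have e3 : c * ((η * t)⁻¹) ^ β =
      c * η₁ ^ (-β) * ((m : ℝ) ^ (β ^ 2 / (β + 1)) * (t : ℝ) ^ (-β)) := by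
    rw [Real.inv_rpow (by positivity), ← Real.rpow_neg (by positivity), hη,
      Real.mul_rpow (by positivity) ht0.le, Real.mul_rpow hη₁.le (by positivity),
      ← Real.rpow_mul hm0.le]
    have : -(β / (β + 1)) * -β = β ^ 2 / (β + 1) := by ring
    rw [this]
    ring
  have b2 : η * G ^ 2 / 2 * (1 + (harmonic (t - 1) : ℝ)) ≤
      4 * η₁ * G ^ 2 * ((m : ℝ) ^ (-(β / (β + 1))) * Real.log t) := by
    have h0 : 0 ≤ η * G ^ 2 / 2 := by positivity
    have h1 := mul_le_mul_of_nonneg_left (one_add_harmonic_le ht) h0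
    have h2 : 0 ≤ η * G ^ 2 * Real.log t := by positivity
    have h3 : 4 * η₁ * G ^ 2 * ((m : ℝ) ^ (-(β / (β + 1))) * Real.log t) =
        4 * (η * G ^ 2 * Real.log t) := by rw [hη]; ring
    rw [h3]
    linarith
  -- The logarithm is inserted through `1 ≤ 2 * log t`, which turns the factor 2 into 4.
  have b1 : 2 * η * G ^ 2 * t / m ≤
      4 * η₁ * G ^ 2 * ((m : ℝ) ^ (-((2 * β + 1) / (β + 1))) * (t : ℝ) * Real.log t) := by
    have h0 : 0 ≤ 2 * η * G ^ 2 * t / m := by positivity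
    have h3 : 4 * η₁ * G ^ 2 * ((m : ℝ) ^ (-((2 * β + 1) / (β + 1))) * (t : ℝ) * Real.log t) =
        (2 * η * G ^ 2 * t / m) * (2 * Real.log t) := by rw [hpow, hη]; ring
    rw [h3]
    nlinarith
  have p1 : 0 ≤ (m : ℝ) ^ (-((2 * β + 1) / (β + 1))) * (t : ℝ) * Real.log t := by positivity
  have p2 : 0 ≤ (m : ℝ) ^ (-(β / (β + 1))) * Real.log t := by positivity
  have p3 : 0 ≤ (m : ℝ) ^ (β ^ 2 / (β + 1)) * (t : ℝ) ^ (-β) := by positivity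
  rw [e3]
  set T1 := (m : ℝ) ^ (-((2 * β + 1) / (β + 1))) * (t : ℝ) * Real.log t
  set T2 := (m : ℝ) ^ (-(β / (β + 1))) * Real.log t
  set T3 := (m : ℝ) ^ (β ^ 2 / (β + 1)) * (t : ℝ) ^ (-β)
  have q0 : 0 ≤ (c + G ^ 2) * (T1 + T2 + T3) := by positivity
  have q1 : 0 ≤ 4 * η₁ * G ^ 2 * T3 := by positivity
  have q2 : 0 ≤ c * η₁ ^ (-β) * (T1 + T2) := by positivity
  linarith

/-- With one pass over the data all three terms are of the order of the second one. -/
theorem one_pass_terms_le {β : ℝ} (hβ : 0 < β) {m : ℕ} (hm : 2 ≤ m) :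
    (m : ℝ) ^ (-((2 * β + 1) / (β + 1))) * (m : ℝ) * Real.log m +
      (m : ℝ) ^ (-(β / (β + 1))) * Real.log m + (m : ℝ) ^ (β ^ 2 / (β + 1)) * (m : ℝ) ^ (-β) ≤
      4 * ((m : ℝ) ^ (-(β / (β + 1))) * Real.log m) := by
  have hm0 : (0 : ℝ) < m := by positivity
  have hlog := one_half_le_log hm
  have e1 : (m : ℝ) ^ (-((2 * β + 1) / (β + 1))) * (m : ℝ) = (m : ℝ) ^ (-(β / (β + 1))) := by
    rw [← Real.rpow_add_one hm0.ne']
    congr 1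
    field_simp
    ring
  have e2 : (m : ℝ) ^ (β ^ 2 / (β + 1)) * (m : ℝ) ^ (-β) = (m : ℝ) ^ (-(β / (β + 1))) := by
    rw [← Real.rpow_add hm0]
    congr 1
    field_simp
    ring
  rw [e1, e2]
  have : 0 < (m : ℝ) ^ (-(β / (β + 1))) := by positivity
  nlinarith

end SGM

end

/-! ### The main theorem -/

theorem corollary3 (β cβ a₀ κ η₁ : ℝ) (hβ0 : 0 < β) (hβ1 : β ≤ 1) (hcβ : 0 < cβ)
    (hη₁ : 0 < η₁) :
    ∃ C : ℝ, 0 < C ∧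
      ∀ (X : Type u) [MeasurableSpace X] (F : Type v) [NormedAddCommGroup F]
        [InnerProductSpace ℝ F] [CompleteSpace F] [TopologicalSpace.SeparableSpace F]
        [MeasurableSpace F] [BorelSpace F]
        (Y : Set ℝ) (ρ : Measure (X × Y)) [IsProbabilityMeasure ρ]
        (V : ℝ → ℝ → ℝ) (Φ : X → F) (L : ℝ),
        Measurable Φ →
        SGM.IsConvexLoss Y V →
        SGM.IsBounded Y V Φ a₀ κ →
        (∀ l : ℝ, 0 < l → SGM.approxError ρ V Φ l ≤ cβ * l ^ β) →
        0 < L →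
        SGM.IsSmoothLoss Y V L →
        η₁ * (κ ^ 2 * L) ≤ 2 →
        ∀ (m : ℕ) [NeZero m] (η : ℕ → ℝ),
          (∀ k, η k = η₁ * (m : ℝ) ^ (-(β / (β + 1)))) →
          ∀ g : (Fin m → X × Y) → (ℕ → Fin m) → ℕ → F,
            (g = SGM.averagedIterate V Φ η ∨ g = SGM.iterate V Φ η) →
            (∀ t : ℕ, 1 ≤ t →
              SGM.ExpectedExcessRiskLE ρ V Φ m (fun z j => g z j t)
                (C * ((m : ℝ) ^ (-((2 * β + 1) / (β + 1))) * (t : ℝ) * Real.log t +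
                  (m : ℝ) ^ (-(β / (β + 1))) * Real.log t +
                  (m : ℝ) ^ (β ^ 2 / (β + 1)) * (t : ℝ) ^ (-β)))) ∧
            (2 ≤ m →
              SGM.ExpectedExcessRiskLE ρ V Φ m (fun z j => g z j m)
                (C * ((m : ℝ) ^ (-(β / (β + 1))) * Real.log m))) := by
  have hC₀ : 0 < cβ + (a₀ * κ) ^ 2 + 4 * η₁ * (a₀ * κ) ^ 2 + cβ * η₁ ^ (-β) := by positivity
  set C₀ := cβ + (a₀ * κ) ^ 2 + 4 * η₁ * (a₀ * κ) ^ 2 + cβ * η₁ ^ (-β) with hC₀_def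
  -- In `C₀`, the part `cβ + (a₀ * κ) ^ 2` pays for `t = 1` and the rest for `t ≥ 2`. The factor 4
  -- is needed only for one pass, where the third term lacks a logarithm and costs `2 * log m`.
  refine ⟨4 * C₀, by positivity, ?_⟩
  intro X _ F _ _ _ _ _ _ Y ρ _ V Φ L hΦ hV hb hD hL hs hstep m _ η hη g hg
  have : SecondCountableTopology F := UniformSpace.secondCountable_of_separable F
  have : Nonempty (X × Y) := nonempty_of_isProbabilityMeasure ρ
  have hm : 1 ≤ m := NeZero.one_le
  have hm1 : (1 : ℝ) ≤ m := by exact_mod_cast hm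
  obtain ⟨c, hc⟩ : ∃ c, c = η₁ * (m : ℝ) ^ (-(β / (β + 1))) := ⟨_, rfl⟩
  have hηc : ∀ k, η k = c := fun k => (hη k).trans hc.symm
  have hc0 : 0 < c := by rw [hc]; positivity
  have hc1 : c ≤ η₁ := by
    rw [hc]
    exact mul_le_of_le_one_right hη₁.le
      (Real.rpow_le_one_of_one_le_of_nonpos hm1 (neg_nonpos.2 (by positivity)))
  obtain ⟨M, h⟩ := SGM.isNonexpansiveSubgradient_pointLoss hΦ hV hb hL hs hc0
    ((mul_le_mul_of_nonneg_right hc1 (by positivity)).trans hstep)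
  have hg' : g = SGM.sgdAverage (SGM.pointGrad V Φ) c ∨ g = SGM.sgd (SGM.pointGrad V Φ) c := by
    refine hg.imp (fun e => ?_) (fun e => ?_) <;> subst e <;> funext z j t
    · exact SGM.averagedIterate_eq_sgdAverage hηc hc0.ne' z j t
    · exact SGM.iterate_eq_sgd hηc z j t
  have large : ∀ t : ℕ, 2 ≤ t → SGM.ExpectedExcessRiskLE ρ V Φ m (fun z j => g z j t)
      (C₀ * ((m : ℝ) ^ (-((2 * β + 1) / (β + 1))) * (t : ℝ) * Real.log t +
        (m : ℝ) ^ (-(β / (β + 1))) * Real.log t +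
        (m : ℝ) ^ (β ^ 2 / (β + 1)) * (t : ℝ) ^ (-β))) := fun t ht =>
    (SGM.expectedExcessRiskLE_sgd ρ h hg' (by omega) (hD _ (by positivity))).mono
      (SGM.error_terms_le hβ0 hη₁ hcβ hm ht hc)
  refine ⟨fun t ht => ?_, fun hm2 => ?_⟩
  · rcases ht.eq_or_lt with rfl | ht
    · have h0 : (fun (z : Fin m → X × Y) j => g z j 1) = fun _ _ => 0 := by
        funext z j
        rcases hg' with rfl | rfl
        · simp [SGM.sgdAverage, SGM.sgd_one]
        · rfl
      rw [h0]
      refine (SGM.expectedExcessRiskLE_zero ρ h (hD 1 one_pos)).mono ?_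
      have h1 : (1 : ℝ) ≤ (m : ℝ) ^ (β ^ 2 / (β + 1)) :=
        Real.one_le_rpow hm1 (by positivity)
      have h2 : cβ + (a₀ * κ) ^ 2 ≤ C₀ := by
        have : 0 ≤ 4 * η₁ * (a₀ * κ) ^ 2 + cβ * η₁ ^ (-β) := by positivity
        linarith
      simp only [Nat.cast_one, Real.log_one, mul_zero, zero_add, Real.one_rpow, mul_one]
      nlinarith [sq_nonneg (a₀ * κ)]
    · refine (large t ht).mono ?_
      have hlog : 0 ≤ Real.log t := Real.log_natCast_nonneg t
      refine mul_le_mul_of_nonneg_right (by linarith) ?_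
      positivity
  · refine (large m hm2).mono ?_
    have := mul_le_mul_of_nonneg_left (SGM.one_pass_terms_le hβ0 hm2) hC₀.le
    linarith
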